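/- Let $k$ be a field, $n\ge 0$, $S_n=k[x_1,\dots,x_n]$, and let $f_1,\dots,f_n$ be a regular sequence in $S_n$ consisting of homogeneous polynomials, with $\deg f_i=d_i$. Put $Q=(f_1,\dots,f_n)$. The Hilbert coefficients of an ideal $I$ of $S_n$ are the numbers $e_0(I),\dots,e_n(I)$ such that, for all sufficiently large $s$, the length $l(S_n/I^s)$ of the $S_n$-module $S_n/I^s$ is finite and $$l(S_n/I^s)=\sum_{i=0}^n(-1)^i e_i(I)\binom{s+n-i-1}{n-i}.$$ Then the Hilbert coefficients of $Q$ exist and are uniquely determined, the multiplicity is $e_0(Q)=\prod_{i=1}^n d_i$, and $e_i(Q)=0$ for all $1\le i\le n$. -/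

import Mathlib

/-- `IsHilbertCoefficients I e` says that `e 0, …, e n` are the Hilbert coefficients of the ideal
`I` of `S = k[x_1, …, x_n]`: for all large `s` the `S`-module `S / I ^ s` has finite length, and
this length is `∑_{i=0}^{n} (-1)^i e_i binom(s + n - i - 1, n - i)`.
(For `s ≥ 1` no subtraction below is truncated, so the right-hand side is the value at `s` of the
polynomial in `s` given by the same formula.) -/
def IsHilbertCoefficients {k : Type*} [Field k] {n : ℕ}
    (I : Ideal (MvPolynomial (Fin n) k)) (e : Fin (n + 1) → ℚ) : Prop :=
  ∀ᶠ s : ℕ in Filter.atTop, ∃ l : ℕ,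
    Module.length (MvPolynomial (Fin n) k) (MvPolynomial (Fin n) k ⧸ I ^ s) = (l : ℕ∞) ∧
    (l : ℚ) = ∑ i : Fin (n + 1),
      (-1 : ℚ) ^ (i : ℕ) * e i * ((s + (n - (i : ℕ)) - 1).choose (n - (i : ℕ)) : ℚ)

/-! Write `S` for the polynomial ring. The point is that `S` is free over `k[f_1, …, f_n]`, a basis
being given by homogeneous lifts `b_j` of a `k`-basis of `S/Q`. The products `f^a b_j` then form a
`k`-basis of `S`, and `Q^s` is spanned by those with `|a| ≥ s`. Hence `dim_k S/Q^s` is the number of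
`a` with `|a| < s` times `dim_k S/Q`, that is `binom(s+n-1, n) ∏ d_i`: only the `i = 0` term
survives.

Freeness is proved by counting. The products span each degree
(`homogeneousSubmodule_le_span_powerProduct`). Regularity gives the Hilbert series `H_{S/Q} = ∏ (1 -
T^{d_i}) H_S` (`quotientHilbertSeries_span_range`), so there are exactly `dim S_m` products of
degree `m`, and they are independent. Since `H_S = (1 - T)^{-n}`, also `H_{S/Q} = ∏ (1 + T + ⋯ +
T^{d_i - 1})`, whose value at `1` is `∏ d_i`.

Length over `S` equals dimension over `k` because `Q^s` contains a power of the ideal of the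
variables, whose residue field is `k`. -/

open MvPolynomial

/-! ### Uniqueness of Hilbert coefficients -/

/-- The functions `s ↦ binom(s + j - 1, j)`, `0 ≤ j ≤ n`, are linearly independent at infinity. -/
lemma eq_zero_of_eventually_sum_mul_choose_eq_zero (n : ℕ) (c : ℕ → ℚ)
    (h : ∀ᶠ s : ℕ in Filter.atTop,
      ∑ j ∈ Finset.range (n + 1), c j * ((s + j - 1).choose j : ℚ) = 0) :
    ∀ j ≤ n, c j = 0 := by
  induction n generalizing c with
  | zero =>
    obtain ⟨s, hs⟩ := h.exists
    intro j hj
    obtain rfl : j = 0 := by omega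
    simpa using hs
  | succ n ih =>
    -- Take the difference of the relations at `s` and `s - 1`. By Pascal's rule `binom(s+j, j+1) -
    -- binom(s+j-1, j+1) = binom(s+j-1, j)`, so the constant term cancels and the other coefficients
    -- move down by one index.
    have key : ∀ j ≤ n, c (j + 1) = 0 := by
      apply ih (fun j => c (j + 1))
      obtain ⟨N, hN⟩ := Filter.eventually_atTop.mp h
      refine Filter.eventually_atTop.mpr ⟨N + 2, fun s hs => ?_⟩
      have h1 := hN s (by omega)
      have h2 := hN (s - 1) (by omega)
      rw [Finset.sum_range_succ'] at h1 h2
      have h3 := sub_eq_zero.mpr (h1.trans h2.symm)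
      rw [← h3]
      simp only [Nat.choose_zero_right, add_sub_add_right_eq_sub, ← Finset.sum_sub_distrib]
      refine Finset.sum_congr rfl fun j _ => ?_
      obtain ⟨t, rfl⟩ : ∃ t, s = t + 1 := ⟨s - 1, by omega⟩
      have e1 : t + 1 + (j + 1) - 1 = (t + j) + 1 := by omega
      have e2 : t + 1 + j - 1 = t + j := by omega
      have e3 : t + 1 - 1 + (j + 1) - 1 = t + j := by omega
      rw [e1, e2, e3, Nat.choose_succ_succ]
      push_cast
      ring
    have h0 : c 0 = 0 := by
      obtain ⟨s, hs⟩ := h.exists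
      rw [Finset.sum_range_succ', Finset.sum_eq_zero] at hs
      · simpa using hs
      · intro j hj
        rw [key j (by simpa [Nat.lt_succ_iff] using hj), zero_mul]
    intro j hj
    cases j with
    | zero => exact h0
    | succ j => exact key j (by omega)

lemma IsHilbertCoefficients.unique {k : Type*} [Field k] {n : ℕ}
    {I : Ideal (MvPolynomial (Fin n) k)} {e e' : Fin (n + 1) → ℚ}
    (h : IsHilbertCoefficients I e) (h' : IsHilbertCoefficients I e') : e = e' := by
  -- Reindexed by `j = n - i`, the lower entry of the binomial coefficient, with the sign absorbed.
  let c : ℕ → ℚ := fun j => (-1 : ℚ) ^ (n - j) *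
    (e ⟨n - j, by omega⟩ - e' ⟨n - j, by omega⟩)
  have hc : ∀ j ≤ n, c j = 0 := by
    apply eq_zero_of_eventually_sum_mul_choose_eq_zero
    filter_upwards [h, h'] with s ⟨l, hl, hle⟩ ⟨l', hl', hle'⟩
    have hll : (l : ℚ) = l' := by
      have : (l : ℕ∞) = l' := hl.symm.trans hl'
      exact_mod_cast this
    have := sub_eq_zero.mpr (hle.symm.trans (hll.trans hle'))
    rw [← Finset.sum_sub_distrib] at this
    rw [← this, ← Finset.sum_range_reflect, Finset.sum_range]
    refine Finset.sum_congr rfl fun i _ => ?_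
    have e1 : n + 1 - 1 - (i : ℕ) = n - i := by omega
    have e2 : n - (n - (i : ℕ)) = i := by omega
    simp only [c, e1, e2, Fin.eta]
    ring
  funext i
  have := hc (n - i) (by omega)
  have e2 : n - (n - (i : ℕ)) = i := by omega
  simp only [c, e2, Fin.eta, mul_eq_zero, pow_eq_zero_iff', neg_eq_zero, one_ne_zero, false_and,
    false_or] at this
  exact sub_eq_zero.mp this

/-! ### Length and dimension -/

/-- If every element of `R` is congruent to a scalar modulo `m`, the length over `R` of a module
killed by a power of `m` is its length over `k`. -/
lemma Module.length_eq_length_of_pow_smul_eq_bot {k R : Type*} [Field k] [CommRing R] [Algebra k R]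
    (m : Ideal R) (hm : Function.Surjective (algebraMap k (R ⧸ m))) (N : ℕ)
    {M : Type*} [AddCommGroup M] [Module R M] [Module k M] [IsScalarTower k R M]
    (hN : (m ^ N • ⊤ : Submodule R M) = ⊥) :
    Module.length R M = Module.length k M := by
  induction N generalizing M with
  | zero =>
    have : Subsingleton M := by
      rw [pow_zero, Ideal.one_eq_top, Submodule.top_smul] at hN
      exact (Submodule.subsingleton_iff R).mp (subsingleton_of_bot_eq_top hN.symm)
    simp [Module.length_eq_zero]
  | succ N ih =>
    -- Both lengths are additive along `0 → mM → M → M/mM → 0`. Induction applies to `mM`, which `m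
    -- ^ N` kills; `M/mM` is a module over `R/m`, onto which both `R` and `k` surject, so its
    -- submodules are the same over all three rings.
    let P : Submodule R M := m • ⊤
    have hex : Function.Exact P.subtype P.mkQ := LinearMap.exact_subtype_mkQ P
    rw [Module.length_eq_add_of_exact P.subtype P.mkQ P.injective_subtype P.mkQ_surjective hex,
      Module.length_eq_add_of_exact (P.subtype.restrictScalars k) (P.mkQ.restrictScalars k)
        P.injective_subtype P.mkQ_surjective hex]
    congr 1
    · apply ih
      apply Submodule.map_injective_of_injective P.injective_subtype
      rw [Submodule.map_smul'', Submodule.map_subtype_top, Submodule.map_bot, ← hN, pow_succ,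
        ← Submodule.smul_assoc, smul_eq_mul]
    · let : Module (R ⧸ m) (M ⧸ P) := Module.IsTorsionBySet.module (I := m) (by
        rintro x ⟨a, ha⟩
        obtain ⟨y, rfl⟩ := P.mkQ_surjective x
        rw [← map_smul, Submodule.mkQ_apply, Submodule.Quotient.mk_eq_zero]
        exact Submodule.smul_mem_smul ha trivial)
      have : IsScalarTower R (R ⧸ m) (M ⧸ P) := Module.IsTorsionBySet.isScalarTower _
      have : IsScalarTower k (R ⧸ m) (M ⧸ P) := by
        refine ⟨fun a b x => ?_⟩
        obtain ⟨b, rfl⟩ := Ideal.Quotient.mk_surjective b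
        have h1 : a • (Ideal.Quotient.mk m b) = Ideal.Quotient.mk m (a • b) := rfl
        have h2 : ∀ (r : R) (x : M ⧸ P), Ideal.Quotient.mk m r • x = r • x := fun r x => rfl
        rw [h1, h2, h2, smul_assoc]
      rw [Module.length_eq_of_surjective (S := R) (R := R ⧸ m) Ideal.Quotient.mk_surjective,
        Module.length_eq_of_surjective (S := k) (R := R ⧸ m) hm]

/-! ### Homogeneous components -/

namespace MvPolynomial

variable {σ k : Type*} [Field k]

lemma homogeneousComponent_add_mul {f : MvPolynomial σ k} {d : ℕ} (hf : f.IsHomogeneous d)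
    (g : MvPolynomial σ k) (m : ℕ) :
    homogeneousComponent (d + m) (f * g) = f * homogeneousComponent m g := by
  induction g using MvPolynomial.induction_on' with
  | monomial u a =>
    have hu : (monomial u a).IsHomogeneous u.degree := isHomogeneous_monomial a rfl
    rw [homogeneousComponent_of_mem (hf.mul hu), homogeneousComponent_of_mem hu]
    simp
  | add p q hp hq => rw [mul_add, map_add, map_add, mul_add, hp, hq]

lemma homogeneousComponent_mul_of_lt {f : MvPolynomial σ k} {d : ℕ} (hf : f.IsHomogeneous d)
    (g : MvPolynomial σ k) {m : ℕ} (hm : m < d) :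
    homogeneousComponent m (f * g) = 0 := by
  induction g using MvPolynomial.induction_on' with
  | monomial u a =>
    have hu : (monomial u a).IsHomogeneous u.degree := isHomogeneous_monomial a rfl
    rw [homogeneousComponent_of_mem (hf.mul hu), if_neg (by omega)]
  | add p q hp hq => rw [mul_add, map_add, hp, hq, add_zero]

lemma homogeneousComponent_mem_span {s : Set (MvPolynomial σ k)}
    (hs : ∀ f ∈ s, ∃ d, f.IsHomogeneous d) {p : MvPolynomial σ k} (hp : p ∈ Ideal.span s) (m : ℕ) :
    homogeneousComponent m p ∈ Ideal.span s := by
  induction hp using Submodule.span_induction generalizing m with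
  | mem x hx =>
    obtain ⟨d, hd⟩ := hs x hx
    rw [homogeneousComponent_of_mem hd]
    split_ifs
    · exact Ideal.subset_span hx
    · exact zero_mem _
  | zero => simp
  | add x y _ _ hx hy => rw [map_add]; exact add_mem (hx m) (hy m)
  | smul a x hx' hx =>
    classical
    rw [smul_eq_mul, ← sum_homogeneousComponent a, Finset.sum_mul, map_sum]
    refine sum_mem fun i _ => ?_
    have ha := homogeneousComponent_isHomogeneous i a
    rcases lt_or_ge m i with h | h
    · rw [homogeneousComponent_mul_of_lt ha _ h]; exact zero_mem _
    · obtain ⟨j, rfl⟩ := Nat.exists_eq_add_of_le h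
      rw [homogeneousComponent_add_mul ha]
      exact Ideal.mul_mem_left _ _ (hx j)

end MvPolynomial

/-! ### Exponent vectors of given weight -/

/-- The exponent vectors `a` of weight `∑ i, d i * a i = p`, for positive weights `d`. -/
def weightFiber {n : ℕ} (d : Fin n → ℕ) (p : ℕ) : Finset (Fin n → ℕ) :=
  (Fintype.piFinset fun _ => Finset.range (p + 1)).filter fun a => ∑ i, d i * a i = p

/-- Positivity gives `a i ≤ d i * a i ≤ p`, so the bounding box in the definition excludes no
solution. -/
lemma mem_weightFiber {n : ℕ} {d : Fin n → ℕ} (hd : ∀ i, 0 < d i) {p : ℕ} {a : Fin n → ℕ} :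
    a ∈ weightFiber d p ↔ ∑ i, d i * a i = p := by
  simp only [weightFiber, Finset.mem_filter, Fintype.mem_piFinset, Finset.mem_range,
    and_iff_right_iff_imp]
  rintro rfl i
  have h1 : d i * a i ≤ ∑ i, d i * a i :=
    Finset.single_le_sum (f := fun i => d i * a i) (fun _ _ => Nat.zero_le _) (Finset.mem_univ i)
  have h2 := Nat.le_mul_of_pos_left (a i) (hd i)
  omega

lemma PowerSeries.mk_dvd_mul_one_sub_X_pow {d : ℕ} (hd : 0 < d) :
    PowerSeries.mk (fun m => if d ∣ m then (1 : ℤ) else 0) * (1 - PowerSeries.X ^ d) = 1 := by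
  ext m
  rw [mul_sub, mul_one, map_sub, PowerSeries.coeff_mul_X_pow', PowerSeries.coeff_mk,
    PowerSeries.coeff_one]
  rcases lt_or_ge m d with h | h
  · rw [if_neg (not_le.mpr h), sub_zero]
    congr 1
    exact propext ⟨fun hdm => Nat.eq_zero_of_dvd_of_lt hdm h, fun h0 => h0 ▸ dvd_zero d⟩
  · have hm : m ≠ 0 := by omega
    rw [if_pos h, PowerSeries.coeff_mk, if_neg hm, sub_eq_zero]
    congr 1
    exact propext (Nat.dvd_sub_iff_left h dvd_rfl).symm

/-- Expand `∏ 1 / (1 - T^{d_i})` as a product of geometric series: a nonzero contribution to the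
coefficient of `T^p` is a splitting of `p` into parts `l_i = d_i a_i`. -/
lemma mk_card_weightFiber_mul_prod {n : ℕ} {d : Fin n → ℕ} (hd : ∀ i, 0 < d i) :
    PowerSeries.mk (fun p => ((weightFiber d p).card : ℤ)) *
      ∏ i, (1 - PowerSeries.X ^ d i) = 1 := by
  have : PowerSeries.mk (fun p => ((weightFiber d p).card : ℤ)) =
      ∏ i, PowerSeries.mk (fun m => if d i ∣ m then (1 : ℤ) else 0) := by
    ext p
    rw [PowerSeries.coeff_prod]
    simp only [PowerSeries.coeff_mk, Finset.prod_boole, Finset.mem_univ, true_imp_iff,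
      Finset.sum_boole, Nat.cast_inj]
    refine Finset.card_bij (fun a _ => Finsupp.equivFunOnFinite.symm fun i => d i * a i) ?_ ?_ ?_
    · intro a ha
      rw [mem_weightFiber hd] at ha
      simp [ha]
    · intro a _ b _ hab
      funext i
      have := DFunLike.congr_fun hab i
      simpa [(hd i).ne'] using this
    · intro l hl
      simp only [Finset.mem_filter, Finset.mem_finsuppAntidiag, Finset.subset_univ,
        and_true] at hl
      choose a ha using hl.2
      refine ⟨a, ?_, ?_⟩
      · rw [mem_weightFiber hd, ← hl.1]
        exact Finset.sum_congr rfl fun i _ => (ha i).symm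
      · ext i
        simp [ha i]
  rw [this, ← Finset.prod_mul_distrib]
  exact Finset.prod_eq_one fun i _ => PowerSeries.mk_dvd_mul_one_sub_X_pow (hd i)

lemma card_weightFiber_one (n p : ℕ) :
    (weightFiber (fun _ : Fin n => 1) p).card = n.multichoose p := by
  have h := Finset.card_finsuppAntidiag_nat_eq_multichoose (s := (Finset.univ : Finset (Fin n))) p
  rw [Finset.card_univ, Fintype.card_fin] at h
  rw [← h]
  refine Finset.card_bij (fun a _ => Finsupp.equivFunOnFinite.symm a) ?_ ?_ ?_
  · intro a ha
    rw [mem_weightFiber (by simp)] at ha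
    simpa using ha
  · intro a _ b _ hab
    exact Finsupp.equivFunOnFinite.symm.injective hab
  · intro l hl
    refine ⟨Finsupp.equivFunOnFinite l, ?_, by simp⟩
    rw [mem_weightFiber (by simp)]
    simpa using hl

/-! ### The Hilbert series of a homogeneous ideal -/

namespace MvPolynomial

variable {k : Type*} [Field k] {n : ℕ}

instance finite_homogeneousSubmodule (m : ℕ) :
    Module.Finite k (homogeneousSubmodule (Fin n) k m) :=
  Module.Finite.iff_fg.mpr (homogeneousSubmodule_fg (Fin n) k m)

lemma finrank_homogeneousSubmodule (m : ℕ) :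
    Module.finrank k (homogeneousSubmodule (Fin n) k m) =
      (weightFiber (fun _ : Fin n => 1) m).card := by
  let v : weightFiber (fun _ : Fin n => 1) m → MvPolynomial (Fin n) k :=
    fun a => monomial (Finsupp.equivFunOnFinite.symm a.1) 1
  have hv : LinearIndependent k v := by
    have := (basisMonomials (Fin n) k).linearIndependent.comp
      (fun a : weightFiber (fun _ : Fin n => 1) m => Finsupp.equivFunOnFinite.symm a.1)
      (fun a b hab => Subtype.ext (Finsupp.equivFunOnFinite.symm.injective hab))
    simpa [Function.comp_def, v] using this
  have hspan : Submodule.span k (Set.range v) = homogeneousSubmodule (Fin n) k m := by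
    apply le_antisymm
    · rw [Submodule.span_le]
      rintro _ ⟨⟨a, ha⟩, rfl⟩
      rw [mem_weightFiber (by simp)] at ha
      refine isHomogeneous_monomial _ ?_
      simpa [Finsupp.degree_eq_sum] using ha
    · intro p hp
      rw [p.as_sum]
      refine sum_mem fun u hu => ?_
      have hum : u.degree = m := by
        by_contra h
        exact (mem_support_iff.mp hu) (IsHomogeneous.coeff_eq_zero hp h)
      rw [← mul_one (coeff u p), ← smul_eq_mul, ← smul_monomial]
      refine Submodule.smul_mem _ _ (Submodule.subset_span ⟨⟨Finsupp.equivFunOnFinite u, ?_⟩, ?_⟩)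
      · rw [mem_weightFiber (by simp)]
        simpa [Finsupp.degree_eq_sum] using hum
      · simp [v]
  rw [← hspan, finrank_span_eq_card hv, Fintype.card_coe]

/-- The degree `m` part of an ideal. -/
noncomputable def degreePart (I : Ideal (MvPolynomial (Fin n) k)) (m : ℕ) :
    Submodule k (MvPolynomial (Fin n) k) :=
  I.restrictScalars k ⊓ homogeneousSubmodule (Fin n) k m

instance finite_degreePart (I : Ideal (MvPolynomial (Fin n) k)) (m : ℕ) :
    Module.Finite k (degreePart I m) :=
  Submodule.finiteDimensional_of_le inf_le_right

/-- The Hilbert series of the quotient by an ideal. -/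
noncomputable def quotientHilbertSeries (I : Ideal (MvPolynomial (Fin n) k)) : PowerSeries ℤ :=
  PowerSeries.mk fun m => (Module.finrank k (homogeneousSubmodule (Fin n) k m) : ℤ) -
    Module.finrank k (degreePart I m)

lemma finrank_map_mulLeft {f : MvPolynomial (Fin n) k} (hf : f ≠ 0)
    (W : Submodule k (MvPolynomial (Fin n) k)) :
    Module.finrank k (W.map (LinearMap.mulLeft k f)) = Module.finrank k W :=
  (Submodule.equivMapOfInjective _ (mul_right_injective₀ hf) W).symm.finrank_eq

/-- Dimension count for `0 → (S/I)(-d) → S/I → S/(I + (f)) → 0`. In degree `d + j` the new ideal is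
`I_{d+j} + f S_j`, and regularity makes the intersection of the two summands `f I_j`; below degree
`d` nothing changes. -/
lemma quotientHilbertSeries_sup_span_singleton {I : Ideal (MvPolynomial (Fin n) k)}
    (hI : ∀ p ∈ I, ∀ m, homogeneousComponent m p ∈ I) {f : MvPolynomial (Fin n) k} {d : ℕ}
    (hf : f.IsHomogeneous d) (hf0 : f ≠ 0) (hreg : ∀ g, f * g ∈ I → g ∈ I) :
    quotientHilbertSeries (I ⊔ Ideal.span {f}) =
      (1 - PowerSeries.X ^ d) * quotientHilbertSeries I := by
  ext m
  rw [sub_mul, one_mul, map_sub, PowerSeries.coeff_X_pow_mul']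
  simp only [quotientHilbertSeries, PowerSeries.coeff_mk]
  have hmem : ∀ p, p ∈ degreePart (I ⊔ Ideal.span {f}) m →
      ∃ q ∈ I, ∃ g, p = homogeneousComponent m q + homogeneousComponent m (f * g) := by
    rintro p ⟨hp, hpm⟩
    obtain ⟨q, hq, r, hr, rfl⟩ := Submodule.mem_sup.mp hp
    obtain ⟨g, rfl⟩ := Ideal.mem_span_singleton'.mp hr
    refine ⟨q, hq, g, ?_⟩
    rw [mul_comm f g, ← map_add]
    exact (homogeneousComponent_eq_self hpm).symm
  split_ifs with hdm
  · obtain ⟨j, rfl⟩ := Nat.exists_eq_add_of_le hdm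
    rw [Nat.add_sub_cancel_left]
    have hsup : degreePart (I ⊔ Ideal.span {f}) (d + j) = degreePart I (d + j) ⊔
        (homogeneousSubmodule (Fin n) k j).map (LinearMap.mulLeft k f) := by
      apply le_antisymm
      · intro p hp
        obtain ⟨q, hq, g, rfl⟩ := hmem p hp
        rw [homogeneousComponent_add_mul hf]
        exact Submodule.add_mem_sup ⟨hI q hq _, homogeneousComponent_isHomogeneous _ _⟩
          ⟨_, homogeneousComponent_isHomogeneous j g, rfl⟩
      · refine sup_le (fun p hp => ⟨Ideal.mem_sup_left hp.1, hp.2⟩) ?_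
        rintro _ ⟨g, hg, rfl⟩
        exact ⟨Ideal.mem_sup_right (Ideal.mem_span_singleton.mpr (dvd_mul_right f g)),
          hf.mul hg⟩
    have hinf : degreePart I (d + j) ⊓
        (homogeneousSubmodule (Fin n) k j).map (LinearMap.mulLeft k f) =
        (degreePart I j).map (LinearMap.mulLeft k f) := by
      apply le_antisymm
      · rintro _ ⟨hp, g, hg, rfl⟩
        exact ⟨g, ⟨hreg g hp.1, hg⟩, rfl⟩
      · rintro _ ⟨g, hg, rfl⟩
        exact ⟨⟨Ideal.mul_mem_left _ _ hg.1, hf.mul hg.2⟩, g, hg.2, rfl⟩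
    have := Submodule.finrank_sup_add_finrank_inf_eq (degreePart I (d + j))
      ((homogeneousSubmodule (Fin n) k j).map (LinearMap.mulLeft k f))
    rw [← hsup, hinf, finrank_map_mulLeft hf0, finrank_map_mulLeft hf0] at this
    omega
  · have : degreePart (I ⊔ Ideal.span {f}) m = degreePart I m := by
      apply le_antisymm
      · intro p hp
        obtain ⟨q, hq, g, rfl⟩ := hmem p hp
        rw [homogeneousComponent_mul_of_lt hf _ (not_le.mp hdm), add_zero]
        exact ⟨hI q hq _, homogeneousComponent_isHomogeneous _ _⟩
      · exact fun p hp => ⟨Ideal.mem_sup_left hp.1, hp.2⟩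
    rw [this, sub_zero]

lemma quotientHilbertSeries_bot :
    quotientHilbertSeries (⊥ : Ideal (MvPolynomial (Fin n) k)) =
      PowerSeries.mk fun m => (Module.finrank k (homogeneousSubmodule (Fin n) k m) : ℤ) := by
  ext m
  have : degreePart (⊥ : Ideal (MvPolynomial (Fin n) k)) m = ⊥ :=
    (Submodule.eq_bot_iff _).mpr fun p hp => hp.1
  simp [quotientHilbertSeries, this]

/-- The ideal generated by the first `i` members of a family. -/
noncomputable def initialIdeal (f : Fin n → MvPolynomial (Fin n) k) (i : ℕ) : Ideal (MvPolynomial (Fin n) k) :=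
  Ideal.span (f '' {j | (j : ℕ) < i})

lemma initialIdeal_le_span_range (f : Fin n → MvPolynomial (Fin n) k) (i : ℕ) :
    initialIdeal f i ≤ Ideal.span (Set.range f) :=
  Ideal.span_mono (Set.image_subset_range _ _)

lemma initialIdeal_self (f : Fin n → MvPolynomial (Fin n) k) :
    initialIdeal f n = Ideal.span (Set.range f) := by
  rw [initialIdeal, ← Set.image_univ]
  congr 2
  ext j
  simp

lemma initialIdeal_succ (f : Fin n → MvPolynomial (Fin n) k) (i : Fin n) :
    initialIdeal f (i + 1) = initialIdeal f i ⊔ Ideal.span {f i} := by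
  rw [initialIdeal, initialIdeal, ← Ideal.span_union, ← Set.image_singleton, ← Set.image_union]
  congr 2
  ext j
  simp only [Set.mem_ofPred_eq, Set.mem_union, Set.mem_singleton_iff, Fin.ext_iff]
  omega

lemma mem_initialIdeal_of_mul_mem {f : Fin n → MvPolynomial (Fin n) k}
    (hreg : RingTheory.Sequence.IsRegular (MvPolynomial (Fin n) k) (List.ofFn f)) (i : Fin n)
    {g : MvPolynomial (Fin n) k} (hg : f i * g ∈ initialIdeal f i) : g ∈ initialIdeal f i := by
  have h := hreg.toIsWeaklyRegular.regular_mod_prev i (by simp)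
  have hset : (Ideal.ofList ((List.ofFn f).take i) • ⊤ :
      Submodule (MvPolynomial (Fin n) k) (MvPolynomial (Fin n) k)) = initialIdeal f i := by
    rw [smul_eq_mul, Ideal.mul_top, Ideal.ofList, initialIdeal]
    congr 1
    ext r
    simp only [List.mem_take_iff_getElem, List.getElem_ofFn, List.length_ofFn, Set.mem_ofPred_eq,
      Set.mem_image]
    constructor
    · rintro ⟨j, hj, rfl⟩
      exact ⟨⟨j, by omega⟩, by simp; omega, rfl⟩
    · rintro ⟨j, hj, rfl⟩
      exact ⟨j, by omega, rfl⟩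
  rw [hset, List.getElem_ofFn] at h
  rw [← Ideal.Quotient.eq_zero_iff_mem] at hg ⊢
  refine h ?_
  change f i • Ideal.Quotient.mk (initialIdeal f i) g = f i • 0
  rw [smul_zero, ← hg]
  rfl

lemma span_range_ne_top {f : Fin n → MvPolynomial (Fin n) k}
    (hreg : RingTheory.Sequence.IsRegular (MvPolynomial (Fin n) k) (List.ofFn f)) :
    Ideal.span (Set.range f) ≠ ⊤ := by
  have h := hreg.top_ne_smul
  rw [smul_eq_mul, Ideal.mul_top, Ideal.ofList] at h
  have : {r | r ∈ List.ofFn f} = Set.range f := by ext; simp [List.mem_ofFn]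
  rw [this] at h
  exact h.symm

/-- If `f i = 0`, then `f i * 1` lies in the ideal of the earlier members, hence so does `1`, and
the sequence generates the unit ideal. -/
lemma ne_zero_of_isRegular {f : Fin n → MvPolynomial (Fin n) k}
    (hreg : RingTheory.Sequence.IsRegular (MvPolynomial (Fin n) k) (List.ofFn f)) (i : Fin n) :
    f i ≠ 0 := by
  intro h0
  apply span_range_ne_top hreg
  rw [Ideal.eq_top_iff_one]
  apply initialIdeal_le_span_range f i
  apply mem_initialIdeal_of_mul_mem hreg
  rw [h0, zero_mul]
  exact zero_mem _

/-- A nonzero form of degree zero is a unit, but the sequence generates a proper ideal. -/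
lemma degree_pos_of_isRegular {f : Fin n → MvPolynomial (Fin n) k} {d : Fin n → ℕ}
    (hdeg : ∀ i, (f i).IsHomogeneous (d i))
    (hreg : RingTheory.Sequence.IsRegular (MvPolynomial (Fin n) k) (List.ofFn f)) (i : Fin n) :
    0 < d i := by
  by_contra h
  have hi := hdeg i
  rw [Nat.eq_zero_of_not_pos h, ← totalDegree_zero_iff_isHomogeneous,
    totalDegree_eq_zero_iff_eq_C] at hi
  have hc : coeff 0 (f i) ≠ 0 := fun hc => ne_zero_of_isRegular hreg i (by rw [hi, hc, map_zero])
  apply span_range_ne_top hreg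
  refine Ideal.eq_top_of_isUnit_mem _ (Ideal.subset_span ⟨i, rfl⟩) ?_
  rw [hi]
  exact (IsUnit.mk0 _ hc).map C

lemma quotientHilbertSeries_span_range {f : Fin n → MvPolynomial (Fin n) k} {d : Fin n → ℕ}
    (hdeg : ∀ i, (f i).IsHomogeneous (d i))
    (hreg : RingTheory.Sequence.IsRegular (MvPolynomial (Fin n) k) (List.ofFn f)) :
    quotientHilbertSeries (Ideal.span (Set.range f)) =
      (∏ i, (1 - PowerSeries.X ^ d i)) *
        PowerSeries.mk fun m => (Module.finrank k (homogeneousSubmodule (Fin n) k m) : ℤ) := by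
  have key : ∀ i ≤ n, quotientHilbertSeries (initialIdeal f i) =
      (∏ j with (j : Fin n).val < i, (1 - PowerSeries.X ^ d j)) *
        quotientHilbertSeries (⊥ : Ideal (MvPolynomial (Fin n) k)) := by
    intro i hi
    induction i with
    | zero => simp [initialIdeal]
    | succ i ih =>
      have hfilter : (Finset.univ.filter fun j : Fin n => j.val < i + 1) =
          insert ⟨i, hi⟩ (Finset.univ.filter fun j : Fin n => j.val < i) := by
        ext j
        simp only [Finset.mem_filter, Finset.mem_univ, true_and, Finset.mem_insert, Fin.ext_iff]
        omega
      rw [initialIdeal_succ f ⟨i, hi⟩, quotientHilbertSeries_sup_span_singleton _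
        (hdeg ⟨i, hi⟩) (ne_zero_of_isRegular hreg _)
        (fun g hg => mem_initialIdeal_of_mul_mem hreg _ hg), ih (by omega), hfilter,
        Finset.prod_insert (by simp), mul_assoc]
      intro p hp m
      refine homogeneousComponent_mem_span ?_ hp m
      rintro _ ⟨j, _, rfl⟩
      exact ⟨_, hdeg j⟩
  rw [← initialIdeal_self, key n le_rfl, quotientHilbertSeries_bot]
  simp

/-- Bézout's formula for the Hilbert series of a complete intersection of dimension zero. -/
lemma quotientHilbertSeries_eq_prod_geom_sum {f : Fin n → MvPolynomial (Fin n) k} {d : Fin n → ℕ}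
    (hdeg : ∀ i, (f i).IsHomogeneous (d i))
    (hreg : RingTheory.Sequence.IsRegular (MvPolynomial (Fin n) k) (List.ofFn f)) :
    quotientHilbertSeries (Ideal.span (Set.range f)) =
      ((∏ i, ∑ j ∈ Finset.range (d i), Polynomial.X ^ j : Polynomial ℤ) : PowerSeries ℤ) := by
  -- With all weights `1` this says `H_S (1 - T)^n = 1`; it cancels the factor `(1 - T)^n` extracted
  -- from `∏ (1 - T^{d_i})`.
  have h1 := mk_card_weightFiber_mul_prod (d := fun _ : Fin n => 1) (by simp)
  have h2 : (∏ i, (1 - PowerSeries.X ^ d i) : PowerSeries ℤ) =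
      ((∏ i, ∑ j ∈ Finset.range (d i), Polynomial.X ^ j : Polynomial ℤ) : PowerSeries ℤ) *
        ∏ _i : Fin n, (1 - PowerSeries.X ^ 1) := by
    have h3 : (∏ i, (1 - Polynomial.X ^ d i) : Polynomial ℤ) =
      (∏ i, ∑ j ∈ Finset.range (d i), Polynomial.X ^ j) *
        ∏ _i : Fin n, (1 - Polynomial.X ^ 1) := by
      rw [← Finset.prod_mul_distrib]
      refine Finset.prod_congr rfl fun i _ => ?_
      rw [pow_one, geom_sum_mul_neg]
    have h4 := congrArg (Polynomial.coeToPowerSeries.ringHom (R := ℤ)) h3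
    simpa [map_prod] using h4
  rw [quotientHilbertSeries_span_range hdeg hreg, h2]
  simp_rw [finrank_homogeneousSubmodule]
  rw [mul_assoc, mul_comm (∏ _i : Fin n, _), h1, mul_one]

end MvPolynomial

/-! ### Products of powers of a regular sequence with lifts of a basis of the quotient -/

namespace MvPolynomial

variable {k : Type*} [Field k] {n : ℕ}

/-- Homogeneous elements are linearly independent if those of each degree are. -/
lemma linearIndependent_of_isHomogeneous {σ J : Type*} {v : J → MvPolynomial σ k} {deg : J → ℕ}
    (hv : ∀ j, (v j).IsHomogeneous (deg j)) (h : ∀ m, LinearIndepOn k v {j | deg j = m}) :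
    LinearIndependent k v := by
  rw [linearIndependent_iff']
  intro s g hg i hi
  have h1 := congrArg (homogeneousComponent (deg i)) hg
  rw [map_sum, map_zero] at h1
  have h2 : ∑ j ∈ s with deg j = deg i, g j • v j = 0 := by
    rw [← h1, Finset.sum_filter]
    refine Finset.sum_congr rfl fun j _ => ?_
    rw [map_smul, homogeneousComponent_of_mem (hv j)]
    split_ifs with h3 h4 h4
    · rfl
    · exact absurd h3.symm h4
    · exact absurd h4.symm h3
    · rw [smul_zero]
  exact linearIndepOn_iff'.mp (h (deg i)) _ g (fun j hj => (Finset.mem_filter.mp hj).2) h2 i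
    (Finset.mem_filter.mpr ⟨hi, rfl⟩)

/-- Homogeneous lifts of a basis of the quotient by a homogeneous ideal. -/
lemma exists_homogeneous_lift (I : Ideal (MvPolynomial (Fin n) k)) :
    ∃ (β : ℕ → ℕ) (b : (m : ℕ) → Fin (β m) → MvPolynomial (Fin n) k),
      (∀ m j, (b m j).IsHomogeneous m) ∧
      (∀ m, homogeneousSubmodule (Fin n) k m ≤
        degreePart I m ⊔ Submodule.span k (Set.range (b m))) ∧
      ∀ m, (β m : ℤ) = PowerSeries.coeff m (quotientHilbertSeries I) := by
  have key : ∀ m, ∃ W : Submodule k (MvPolynomial (Fin n) k),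
      W ≤ homogeneousSubmodule (Fin n) k m ∧ homogeneousSubmodule (Fin n) k m = degreePart I m ⊔ W ∧
      degreePart I m ⊓ W = ⊥ := by
    intro m
    obtain ⟨W, hW⟩ := Submodule.exists_isCompl (degreePart I m)
    -- By the modular law, a complement of `I_m` in `S` cut down to `S_m` is a complement of `I_m`
    -- in `S_m`.
    refine ⟨W ⊓ homogeneousSubmodule (Fin n) k m, inf_le_right, ?_, ?_⟩
    · have hle : degreePart I m ≤ homogeneousSubmodule (Fin n) k m := inf_le_right
      rw [← sup_inf_assoc_of_le _ hle, hW.sup_eq_top, top_inf_eq]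
    · rw [← inf_assoc, hW.inf_eq_bot, bot_inf_eq]
  choose W hWle hsup hinf using key
  have hfin : ∀ m, Module.Finite k (W m) := fun m => Submodule.finiteDimensional_of_le (hWle m)
  refine ⟨fun m => Module.finrank k (W m), fun m j => Module.finBasis k (W m) j,
    fun m j => hWle m (Module.finBasis k (W m) j).2, fun m => ?_, fun m => ?_⟩
  · have : Submodule.span k (Set.range fun j => (Module.finBasis k (W m) j : MvPolynomial (Fin n) k))
        = W m := by
      have h := congrArg (Submodule.map (W m).subtype) (Module.finBasis k (W m)).span_eq
      rwa [Submodule.map_span, Submodule.map_subtype_top, ← Set.range_comp] at h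
    rw [this, ← hsup m]
  · have h := Submodule.finrank_sup_add_finrank_inf_eq (degreePart I m) (W m)
    rw [← hsup m, hinf m, finrank_bot] at h
    simp only [quotientHilbertSeries, PowerSeries.coeff_mk]
    omega

section PowerProduct

variable (f : Fin n → MvPolynomial (Fin n) k) {β : ℕ → ℕ}
  (b : (m : ℕ) → Fin (β m) → MvPolynomial (Fin n) k)

/-- The product of the power `f ^ a` and a member of the family `b`. -/
noncomputable def powerProduct (j : (Fin n → ℕ) × (Σ m, Fin (β m))) : MvPolynomial (Fin n) k :=
  (∏ i, f i ^ j.1 i) * b j.2.1 j.2.2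

lemma mul_powerProduct (i : Fin n) (j : (Fin n → ℕ) × (Σ m, Fin (β m))) :
    f i * powerProduct f b j = powerProduct f b (j.1 + Pi.single i 1, j.2) := by
  simp only [powerProduct, Pi.add_apply, pow_add, Finset.prod_mul_distrib]
  rw [Finset.prod_eq_single (f := fun l => f l ^ (Pi.single i 1 : Fin n → ℕ) l) i
    (fun l _ hl => by simp [Pi.single_eq_of_ne hl]) (by simp)]
  simp only [Pi.single_eq_same, pow_one]
  ring

/-- Multiplication by `f i` only shifts indices. The sets `T`, `T'` are left free so as to serve
both the filtration by weighted degree and that by `|a|`. -/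
lemma mul_mem_span_powerProduct (i : Fin n) {T T' : Set ((Fin n → ℕ) × (Σ m, Fin (β m)))}
    (hT : ∀ j ∈ T, (j.1 + Pi.single i 1, j.2) ∈ T') {p : MvPolynomial (Fin n) k}
    (hp : p ∈ Submodule.span k (powerProduct f b '' T)) :
    f i * p ∈ Submodule.span k (powerProduct f b '' T') := by
  have h : Submodule.span k (powerProduct f b '' T) ≤
      (Submodule.span k (powerProduct f b '' T')).comap (LinearMap.mulLeft k (f i)) := by
    rw [Submodule.span_le]
    rintro _ ⟨j, hj, rfl⟩
    change f i * powerProduct f b j ∈ Submodule.span k (powerProduct f b '' T')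
    rw [mul_powerProduct]
    exact Submodule.subset_span ⟨_, hT j hj, rfl⟩
  exact h hp

lemma sum_mul_add_single (d : Fin n → ℕ) (a : Fin n → ℕ) (i : Fin n) :
    ∑ l, d l * (a + Pi.single i 1 : Fin n → ℕ) l = (∑ l, d l * a l) + d i := by
  simp [mul_add, Finset.sum_add_distrib, Pi.single_apply]

/-- The weighted degree of `powerProduct`. -/
def powerProductDegree (d : Fin n → ℕ) (j : (Fin n → ℕ) × (Σ m, Fin (β m))) : ℕ :=
  (∑ i, d i * j.1 i) + j.2.1

variable {f b} {d : Fin n → ℕ}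

lemma isHomogeneous_powerProduct (hdeg : ∀ i, (f i).IsHomogeneous (d i))
    (hb : ∀ m j, (b m j).IsHomogeneous m) (j : (Fin n → ℕ) × (Σ m, Fin (β m))) :
    (powerProduct f b j).IsHomogeneous (powerProductDegree d j) :=
  (IsHomogeneous.prod _ _ _ fun i _ => (hdeg i).pow _).mul (hb _ _)

/-- Graded Nakayama: modulo the span of `b m`, a form of degree `m` is `∑ f_i c_i` with `c_i` of
degree `m - d_i < m`, and induction applies to the `c_i`. -/
lemma homogeneousSubmodule_le_span_powerProduct (hdeg : ∀ i, (f i).IsHomogeneous (d i))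
    (hd : ∀ i, 0 < d i)
    (hspan : ∀ m, homogeneousSubmodule (Fin n) k m ≤
      degreePart (Ideal.span (Set.range f)) m ⊔ Submodule.span k (Set.range (b m))) (m : ℕ) :
    homogeneousSubmodule (Fin n) k m ≤
      Submodule.span k (powerProduct f b '' {j | powerProductDegree d j = m}) := by
  induction m using Nat.strong_induction_on with
  | _ m ih =>
    refine (hspan m).trans (sup_le ?_ ?_)
    · rintro q ⟨hq, hqm⟩
      obtain ⟨c, rfl⟩ := Ideal.mem_span_range_iff_exists_fun.mp hq
      rw [← homogeneousComponent_eq_self hqm, map_sum]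
      refine sum_mem fun i _ => ?_
      rw [mul_comm]
      rcases lt_or_ge m (d i) with h | h
      · rw [homogeneousComponent_mul_of_lt (hdeg i) _ h]
        exact zero_mem _
      · obtain ⟨l, rfl⟩ := Nat.exists_eq_add_of_le h
        rw [homogeneousComponent_add_mul (hdeg i)]
        have := hd i
        refine mul_mem_span_powerProduct f b i ?_
          (ih l (by omega) (homogeneousComponent_isHomogeneous l (c i)))
        rintro j rfl
        simp only [Set.mem_ofPred_eq, powerProductDegree, sum_mul_add_single]
        omega
    · rw [Submodule.span_le]
      rintro _ ⟨j, rfl⟩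
      exact Submodule.subset_span ⟨(0, ⟨m, j⟩), by simp [powerProductDegree], by
        simp [powerProduct]⟩

/-- The indices of the products of degree `m`. -/
def powerProductFiber (d : Fin n → ℕ) (β : ℕ → ℕ) (m : ℕ) :
    Finset ((Fin n → ℕ) × (Σ m, Fin (β m))) :=
  (Finset.HasAntidiagonal.antidiagonal m).biUnion fun p =>
    weightFiber d p.1 ×ˢ (Finset.univ : Finset (Fin (β p.2))).map ⟨Sigma.mk p.2, sigma_mk_injective⟩

lemma mem_powerProductFiber (hd : ∀ i, 0 < d i) {m : ℕ} {j : (Fin n → ℕ) × (Σ m, Fin (β m))} :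
    j ∈ powerProductFiber d β m ↔ powerProductDegree d j = m := by
  obtain ⟨a, q, l⟩ := j
  simp only [powerProductFiber, powerProductDegree, Finset.mem_biUnion, Finset.HasAntidiagonal.mem_antidiagonal,
    Finset.mem_product, mem_weightFiber hd, Finset.mem_map, Finset.mem_univ, true_and,
    Function.Embedding.coeFn_mk, Prod.exists]
  constructor
  · rintro ⟨p, q', rfl, rfl, l', hl'⟩
    rw [(Sigma.mk.inj_iff.mp hl').1]
  · rintro rfl
    exact ⟨_, _, rfl, rfl, l, rfl⟩

lemma card_powerProductFiber (d : Fin n → ℕ) (β : ℕ → ℕ) (m : ℕ) :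
    (powerProductFiber d β m).card =
      ∑ p ∈ Finset.HasAntidiagonal.antidiagonal m, (weightFiber d p.1).card * β p.2 := by
  rw [powerProductFiber, Finset.card_biUnion]
  · simp
  · rintro ⟨p, q⟩ hp ⟨p', q'⟩ hp' hne
    rw [Function.onFun, Finset.disjoint_left]
    rintro ⟨a, l⟩ h1 h2
    simp only [Finset.mem_product, Finset.mem_map, Finset.mem_univ, true_and,
      Function.Embedding.coeFn_mk] at h1 h2
    obtain ⟨_, rfl⟩ := h1.2
    obtain ⟨_, hl⟩ := h2.2
    have hq : q' = q := (Sigma.mk.inj_iff.mp hl).1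
    rw [Finset.mem_coe, Finset.HasAntidiagonal.mem_antidiagonal] at hp hp'
    dsimp only at hp hp'
    exact hne (Prod.ext (by dsimp only; omega) hq.symm)

/-- The products have generating function `∏ (1 - T^{d_i})^{-1} H_{S/Q}`, which is `H_S` by
regularity. -/
lemma card_powerProductFiber_eq_finrank (hdeg : ∀ i, (f i).IsHomogeneous (d i))
    (hreg : RingTheory.Sequence.IsRegular (MvPolynomial (Fin n) k) (List.ofFn f))
    (hβ : ∀ m, (β m : ℤ) =
      PowerSeries.coeff m (quotientHilbertSeries (Ideal.span (Set.range f)))) (m : ℕ) :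
    (powerProductFiber d β m).card = Module.finrank k (homogeneousSubmodule (Fin n) k m) := by
  have h1 := mk_card_weightFiber_mul_prod (degree_pos_of_isRegular hdeg hreg)
  have h2 := congrArg (PowerSeries.mk (fun p => ((weightFiber d p).card : ℤ)) * ·)
    (quotientHilbertSeries_span_range hdeg hreg)
  simp only [← mul_assoc, h1, one_mul] at h2
  have h3 := congrArg (PowerSeries.coeff m) h2
  rw [PowerSeries.coeff_mul, PowerSeries.coeff_mk] at h3
  simp only [PowerSeries.coeff_mk, ← hβ] at h3
  rw [card_powerProductFiber]
  exact_mod_cast h3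

/-- In each degree the products span a space whose dimension is their number. -/
lemma linearIndependent_powerProduct (hdeg : ∀ i, (f i).IsHomogeneous (d i))
    (hreg : RingTheory.Sequence.IsRegular (MvPolynomial (Fin n) k) (List.ofFn f))
    (hb : ∀ m j, (b m j).IsHomogeneous m)
    (hspan : ∀ m, homogeneousSubmodule (Fin n) k m ≤
      degreePart (Ideal.span (Set.range f)) m ⊔ Submodule.span k (Set.range (b m)))
    (hβ : ∀ m, (β m : ℤ) =
      PowerSeries.coeff m (quotientHilbertSeries (Ideal.span (Set.range f)))) :
    LinearIndependent k (powerProduct f b) := by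
  have hd := degree_pos_of_isRegular hdeg hreg
  refine linearIndependent_of_isHomogeneous (isHomogeneous_powerProduct hdeg hb) fun m => ?_
  have hset : {j | powerProductDegree d j = m} =
      (powerProductFiber d β m : Set ((Fin n → ℕ) × (Σ m, Fin (β m)))) := by
    ext j
    simp [mem_powerProductFiber hd]
  have hle := homogeneousSubmodule_le_span_powerProduct hdeg hd hspan m
  rw [hset] at hle ⊢
  change LinearIndependent k fun j : powerProductFiber d β m => powerProduct f b j
  rw [linearIndependent_iff_card_le_finrank_span, Fintype.card_coe,
    card_powerProductFiber_eq_finrank hdeg hreg hβ, Set.finrank]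
  have : Module.Finite k (Submodule.span k (Set.range
      fun j : powerProductFiber d β m => powerProduct f b j)) :=
    Module.Finite.span_of_finite k (Set.finite_range _)
  refine Submodule.finrank_mono (hle.trans (Submodule.span_mono ?_))
  rintro _ ⟨j, hj, rfl⟩
  exact ⟨⟨j, hj⟩, rfl⟩

lemma top_le_span_powerProduct (hdeg : ∀ i, (f i).IsHomogeneous (d i)) (hd : ∀ i, 0 < d i)
    (hspan : ∀ m, homogeneousSubmodule (Fin n) k m ≤
      degreePart (Ideal.span (Set.range f)) m ⊔ Submodule.span k (Set.range (b m))) :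
    ⊤ ≤ Submodule.span k (Set.range (powerProduct f b)) := by
  intro p _
  rw [← sum_homogeneousComponent p]
  exact sum_mem fun m _ => Submodule.span_mono (Set.image_subset_range _ _)
    (homogeneousSubmodule_le_span_powerProduct hdeg hd hspan m
      (homogeneousComponent_isHomogeneous m p))

/-- Each factor `f i` raises `|a|` by one, which gives `≤` by induction along `Q^{s+1} = Q · Q^s`,
the coefficients being absorbed into `Q^s`. Conversely `f^a` lies in `Q^{|a|}`. Only spanning is
needed here, not independence. -/
lemma span_range_pow_eq_span_powerProduct
    (htop : ⊤ ≤ Submodule.span k (Set.range (powerProduct f b))) (s : ℕ) :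
    (Ideal.span (Set.range f) ^ s).restrictScalars k =
      Submodule.span k (powerProduct f b '' {j | s ≤ ∑ i, j.1 i}) := by
  apply le_antisymm
  · induction s with
    | zero => simpa using htop
    | succ s ih =>
      intro p hp
      rw [Submodule.restrictScalars_mem, pow_succ'] at hp
      induction hp using Submodule.mul_induction_on' with
      | mem_mul_mem x hx y hy =>
        obtain ⟨c, rfl⟩ := Ideal.mem_span_range_iff_exists_fun.mp hx
        rw [Finset.sum_mul]
        refine sum_mem fun i _ => ?_
        rw [mul_comm (c i), mul_assoc]
        refine mul_mem_span_powerProduct f b i ?_ (ih (Ideal.mul_mem_left _ (c i) hy))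
        intro j hj
        have := sum_mul_add_single (fun _ => 1) j.1 i
        simp only [one_mul] at this
        simp only [Set.mem_ofPred_eq, this] at hj ⊢
        omega
      | add x _ y _ hx hy => exact add_mem hx hy
  · rw [Submodule.span_le]
    rintro _ ⟨j, hj, rfl⟩
    refine Ideal.mul_mem_right _ _ (Ideal.pow_le_pow_right hj ?_)
    rw [← Finset.prod_pow_eq_pow_sum]
    exact Ideal.prod_mem_prod fun i _ =>
      Ideal.pow_mem_pow (Ideal.subset_span (Set.mem_range_self i)) _

end PowerProduct

end MvPolynomial

/-! ### The length of the quotients by powers -/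

lemma Module.Basis.finrank_quotient_span_image {k V J : Type*} [Field k] [AddCommGroup V]
    [Module k V] (B : Module.Basis J k V) (T : Set J) (F : Finset J) (hF : (F : Set J) = Tᶜ) :
    Module.Finite k (V ⧸ Submodule.span k (B '' T)) ∧
      Module.finrank k (V ⧸ Submodule.span k (B '' T)) = F.card := by
  have hc : IsCompl (Submodule.span k (B '' T)) (Submodule.span k (B '' F)) := by
    rw [hF]
    refine ⟨B.linearIndependent.disjoint_span_image disjoint_compl_right, ?_⟩
    rw [codisjoint_iff, ← Submodule.span_union, ← Set.image_union, Set.union_compl_self,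
      Set.image_univ, B.span_eq]
  have e := Submodule.quotientEquivOfIsCompl _ _ hc
  have hfin : Module.Finite k (Submodule.span k (B '' F)) :=
    Module.Finite.span_of_finite k (F.finite_toSet.image _)
  refine ⟨Module.Finite.equiv e.symm, ?_⟩
  have hli : LinearIndependent k fun j : F => B j :=
    B.linearIndependent.comp _ Subtype.val_injective
  have hr : B '' F = Set.range fun j : F => B j := by
    ext; simp
  rw [e.finrank_eq, hr, finrank_span_eq_card hli, Fintype.card_coe]

namespace MvPolynomial

variable {k : Type*} [Field k] {n : ℕ}

lemma algebraMap_quotient_idealOfVars_surjective (σ k : Type*) [Field k] :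
    Function.Surjective (algebraMap k (MvPolynomial σ k ⧸ idealOfVars σ k)) := by
  intro x
  obtain ⟨p, rfl⟩ := Ideal.Quotient.mk_surjective x
  refine ⟨coeff 0 p, ?_⟩
  change Ideal.Quotient.mk (idealOfVars σ k) (C (coeff 0 p)) = _
  rw [Ideal.Quotient.eq, ← pow_one (idealOfVars σ k), mem_pow_idealOfVars_iff']
  intro u hu
  obtain rfl : u = 0 := (Finsupp.degree_eq_zero_iff u).mp (by omega)
  simp

lemma pow_idealOfVars_le {I : Ideal (MvPolynomial (Fin n) k)} {D : ℕ}
    (hD : ∀ m, D ≤ m → homogeneousSubmodule (Fin n) k m ≤ degreePart I m) :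
    idealOfVars (Fin n) k ^ D ≤ I := by
  intro p hp
  rw [mem_pow_idealOfVars_iff] at hp
  rw [p.as_sum]
  exact sum_mem fun u hu => (hD u.degree (hp u hu) (isHomogeneous_monomial _ rfl)).1

/-- The length of the quotient by a power of the ideal of a homogeneous system of parameters. -/
theorem length_quotient_span_range_pow {f : Fin n → MvPolynomial (Fin n) k} {d : Fin n → ℕ}
    (hdeg : ∀ i, (f i).IsHomogeneous (d i))
    (hreg : RingTheory.Sequence.IsRegular (MvPolynomial (Fin n) k) (List.ofFn f)) (s : ℕ) :
    Module.length (MvPolynomial (Fin n) k)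
        (MvPolynomial (Fin n) k ⧸ Ideal.span (Set.range f) ^ (s + 1)) =
      (((s + n).choose n * ∏ i, d i : ℕ) : ℕ∞) := by
  obtain ⟨β, b, hb, hspan, hβ⟩ := exists_homogeneous_lift (Ideal.span (Set.range f))
  have hd := degree_pos_of_isRegular hdeg hreg
  have htop := top_le_span_powerProduct hdeg hd hspan
  let P : Polynomial ℤ := ∏ i, ∑ j ∈ Finset.range (d i), Polynomial.X ^ j
  have hβP : ∀ m, (β m : ℤ) = P.coeff m := by
    intro m
    rw [hβ, quotientHilbertSeries_eq_prod_geom_sum hdeg hreg, Polynomial.coeff_coe]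
  -- From degree `D` on `S/Q` vanishes, so there are no lifts and every form lies in `Q`.
  let D := P.natDegree + 1
  have hβ0 : ∀ m, D ≤ m → β m = 0 := by
    intro m hm
    have := hβP m
    rw [Polynomial.coeff_eq_zero_of_natDegree_lt (by omega)] at this
    exact_mod_cast this
  -- The dimension of `S/Q` is the value at `1` of its Hilbert polynomial `P`.
  have hsum : ∑ m ∈ Finset.range D, β m = ∏ i, d i := by
    have h1 : P.eval 1 = ∏ i, (d i : ℤ) := by
      simp [P, Polynomial.eval_prod, Polynomial.eval_finsetSum]
    rw [Polynomial.eval_eq_sum_range] at h1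
    simp only [one_pow, mul_one, ← hβP] at h1
    exact_mod_cast h1
  -- the powers of the variables eventually lie in the ideal
  have hpow : idealOfVars (Fin n) k ^ D ≤ Ideal.span (Set.range f) := by
    refine pow_idealOfVars_le fun m hm => (hspan m).trans (sup_le le_rfl ?_)
    rw [Submodule.span_le]
    rintro _ ⟨j, rfl⟩
    exact absurd j.2 (by simp [hβ0 m hm])
  have hlen := Module.length_eq_length_of_pow_smul_eq_bot (k := k) (idealOfVars (Fin n) k)
    (algebraMap_quotient_idealOfVars_surjective (Fin n) k) (D * (s + 1))
    (M := MvPolynomial (Fin n) k ⧸ Ideal.span (Set.range f) ^ (s + 1)) (by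
      rw [eq_bot_iff, Submodule.smul_le]
      intro r hr x _
      obtain ⟨x, rfl⟩ := Ideal.Quotient.mk_surjective x
      rw [pow_mul] at hr
      exact Ideal.Quotient.eq_zero_iff_mem.mpr
        (Ideal.mul_mem_right x _ (Ideal.pow_right_mono hpow _ hr)))
  -- a basis of the polynomial ring adapted to the powers of the ideal
  let B := Module.Basis.mk (linearIndependent_powerProduct hdeg hreg hb hspan hβ) htop
  -- The basis elements outside `Q^{s+1}`: `|a| ≤ s`, with any lift. Bounding the degree of the lift
  -- by `D` makes the set visibly finite and loses nothing.
  let F : Finset ((Fin n → ℕ) × (Σ m, Fin (β m))) :=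
    ((Finset.range (s + 1)).biUnion (weightFiber fun _ => 1)) ×ˢ
      (Finset.range D).sigma fun _ => Finset.univ
  have hF : (F : Set _) = {j : (Fin n → ℕ) × (Σ m, Fin (β m)) | s + 1 ≤ ∑ i, j.1 i}ᶜ := by
    ext ⟨a, m, j⟩
    have hm : m < D := by
      by_contra h
      exact absurd j.2 (by simp [hβ0 m (not_lt.mp h)])
    simp only [F, Finset.mem_coe, Finset.mem_product, Finset.mem_biUnion, Finset.mem_range,
      mem_weightFiber (d := fun _ : Fin n => 1) (fun _ => one_pos), Finset.mem_sigma,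
      Finset.mem_univ, and_true, one_mul, hm, Set.mem_compl_iff, Set.mem_ofPred_eq, not_le]
    exact ⟨fun ⟨p, hp, h⟩ => h ▸ hp, fun h => ⟨_, h, rfl⟩⟩
  have hcard : F.card = (s + n).choose n * ∏ i, d i := by
    rw [Finset.card_product, Finset.card_sigma, Finset.card_biUnion]
    -- Summing the number of exponent vectors of weight `p` over `p ≤ s` gives `binom(s + n, n)`.
    · simp [card_weightFiber_one, Nat.sum_range_multichoose, hsum]
    · intro p _ q _ hpq
      rw [Function.onFun, Finset.disjoint_left]
      intro a hp hq
      rw [mem_weightFiber (fun _ => one_pos)] at hp hq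
      exact hpq (hp.symm.trans hq)
  obtain ⟨hfin, hrank⟩ := B.finrank_quotient_span_image _ F hF
  rw [show (B : (Fin n → ℕ) × (Σ m, Fin (β m)) → MvPolynomial (Fin n) k) = powerProduct f b from
    Module.Basis.coe_mk _ _, ← span_range_pow_eq_span_powerProduct htop] at hfin hrank
  let e := Submodule.Quotient.restrictScalarsEquiv k (Ideal.span (Set.range f) ^ (s + 1))
  rw [hlen, ← e.length_eq, Module.length_eq_finrank, hrank, hcard]

end MvPolynomial

theorem mainTheorem5 {k : Type*} [Field k] (n : ℕ)
    (f : Fin n → MvPolynomial (Fin n) k) (d : Fin n → ℕ)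
    (hdeg : ∀ i, (f i).IsHomogeneous (d i))
    (hreg : RingTheory.Sequence.IsRegular (MvPolynomial (Fin n) k) (List.ofFn f)) :
    (∃! e : Fin (n + 1) → ℚ, IsHilbertCoefficients (Ideal.span (Set.range f)) e) ∧
    ∀ e : Fin (n + 1) → ℚ, IsHilbertCoefficients (Ideal.span (Set.range f)) e →
      e 0 = ∏ i, (d i : ℚ) ∧ ∀ i : Fin (n + 1), 0 < i → e i = 0 := by
  have h : IsHilbertCoefficients (Ideal.span (Set.range f))
      (Pi.single 0 (∏ i, (d i : ℚ)) : Fin (n + 1) → ℚ) := by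
    -- The formula holds from `s = 1` on; with `s = t + 1` the `i = 0` binomial is `binom(t + n,
    -- n)`, without truncated subtraction.
    refine Filter.eventually_atTop.mpr ⟨1, fun s hs => ?_⟩
    obtain ⟨t, rfl⟩ := Nat.exists_eq_add_of_le' hs
    refine ⟨_, length_quotient_span_range_pow hdeg hreg t, ?_⟩
    rw [Finset.sum_eq_single 0 (fun i _ hi => by simp [Pi.single_eq_of_ne hi]) (by simp)]
    have e1 : t + 1 + n - 1 = t + n := by omega
    simp only [Fin.val_zero, pow_zero, Pi.single_eq_same, one_mul, Nat.sub_zero, e1]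
    push_cast
    ring
  refine ⟨⟨_, h, fun e he => he.unique h⟩, fun e he => ?_⟩
  rw [he.unique h]
  exact ⟨Pi.single_eq_same _ _, fun i hi => Pi.single_eq_of_ne hi.ne' _⟩
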